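/- Write $\binom{d}{\le k}=\sum_{j=1}^{k}\binom{d}{j}$. An online algorithm $M$ over a data universe $\mathcal X$ consists of randomized maps $M_1:\mathcal X\to\mathcal I$ and $M_i:\mathcal X\times\mathcal I\to\mathcal I$ ($i\ge 2$) and an output map $M_{\mathcal O}:\mathcal I\to\mathcal O$. On a stream $\vec x=(x_1,\dots,x_n)$ it computes the states $s_1=M_1(x_1)$, $s_i=M_i(x_i,s_{i-1})$ and outputs $M_{\mathcal O}(s_n)$. It is $(\varepsilon,\delta)$-pan-private (on streams of length $n$) if for all streams $\vec x,\vec x'\in\mathcal X^n$ that differ in at most one element, every time $1\le t\le n$ and every measurable $T\subseteq\mathcal I\times\mathcal O$, $$\Pr[(s_t,M_{\mathcal O}(s_n))\in T\mid \vec x]\le e^{\varepsilon}\Pr[(s_t,M_{\mathcal O}(s_n))\in T\mid \vec x']+\delta .$$ For $\mathcal X=\{\pm1\}^d$, $M$ releases width-$k$ parities with error $\alpha$ and sample complexity $n$ if, for every probability distribution $\mathbf P$ on $\{\pm1\}^d$, when it is run on $n$ independent samples from $\mathbf P$ its output $F:2^{[d]}\to\mathbb R$ satisfies, with probability at least $99/100$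 (over the samples and the algorithm), $\left|F(\ell)-\mathbb E_{x\sim\mathbf P}\left[\prod_{j\in\ell}x_j\right]\right|\le\alpha$ simultaneously for all $\ell\subseteq[d]$ with $|\ell|\le k$. Theorem. For every $\varepsilon_0>0$ there are constants $c,C>0$, depending only on $\varepsilon_0$, such that the following holds for all integers $d\ge k\ge 2$ and $n\ge 0$, and all reals $0<\alpha<1/2$, $0<\varepsilon\le\varepsilon_0$ and $0\le\delta\le1$ with $$\delta\log\frac{\binom{d}{\le k}}{\delta}\le c\cdot\frac{\alpha^2\varepsilon^2}{\binom{d}{\le k}}$$ (where the left-hand side is $0$ if $\delta=0$): if an online algorithm $M$ is $(\varepsilon,\delta)$-pan-private on streams of length $n$ and releases width-$k$ parities with error $\alpha$ and sample complexity $n$, then $$n\ge C\cdot\frac{\sqrt{\binom{d}{\le k}}}{\alpha\varepsilon}.$$ -/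

import Mathlib

open MeasureTheory ProbabilityTheory

/-- A (randomized) online algorithm with data universe `X`, state space `S` and output space `O`:
an internal algorithm `M₁ : X → S`, internal algorithms `Mᵢ : X × S → S` for `i ≥ 2` (each may
depend on the index `i`; the values of `next` at `0` and `1` are never used), and an output
algorithm `S → O`.  Randomized maps are Markov kernels. -/
structure OnlineAlgorithm (X S O : Type*) [MeasurableSpace X] [MeasurableSpace S]
    [MeasurableSpace O] where
  first : Kernel X S
  next : ℕ → Kernel (X × S) S
  output : Kernel S O
  markov_first : IsMarkovKernel first
  markov_next : ∀ i, IsMarkovKernel (next i)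
  markov_output : IsMarkovKernel output

namespace OnlineAlgorithm

variable {X S O : Type*} [MeasurableSpace X] [MeasurableSpace S] [MeasurableSpace O]

/-- The kernel that takes the state held before the `i`-th element of the stream arrives to the
state held after the elements `x` (the first of which is the `i`-th of the stream) have been
processed. -/
noncomputable def process (M : OnlineAlgorithm X S O) : ℕ → List X → Kernel S S
  | _, [] => Kernel.id
  | i, a :: x =>
      (M.process (i + 1) x) ∘ₖ ((M.next i).comap (fun s => (a, s)) measurable_prodMk_left)

/-- The law of the internal state after the stream `x` has been processed.  There is no state
before the first element has arrived; for the empty stream the value is the zero measure. -/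
noncomputable def stateLaw (M : OnlineAlgorithm X S O) : List X → Measure S
  | [] => 0
  | a :: x => (M.first a).bind (M.process 2 x)

/-- The law of the final output on the stream `x`. -/
noncomputable def outputLaw (M : OnlineAlgorithm X S O) (x : List X) : Measure O :=
  (M.stateLaw x).bind M.output

instance isMarkovKernel_process (M : OnlineAlgorithm X S O) (i : ℕ) (x : List X) :
    IsMarkovKernel (M.process i x) := by
  induction x generalizing i with
  | nil => unfold process; infer_instance
  | cons a x ih =>
    have := M.markov_next i
    have := ih (i + 1)
    unfold process
    infer_instance

instance isFiniteMeasure_stateLaw (M : OnlineAlgorithm X S O) (x : List X) :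
    IsFiniteMeasure (M.stateLaw x) := by
  cases x with
  | nil => unfold stateLaw; infer_instance
  | cons a x =>
    have := M.markov_first
    unfold stateLaw
    infer_instance

/-- The joint law of the internal state after the first `t` elements of the stream `x` and the
final output on the whole stream `x` (in the same execution). -/
noncomputable def viewLaw (M : OnlineAlgorithm X S O) (x : List X) (t : ℕ) : Measure (S × O) :=
  (M.stateLaw (x.take t)) ⊗ₘ (M.output ∘ₖ M.process (t + 1) (x.drop t))

/-- `(ε, δ)`-pan-privacy on streams of length `n`: for every two neighboring streams (they differ
in at most one element) and every time `1 ≤ t ≤ n`, the joint laws of (state at time `t`, output)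
are `(ε, δ)`-indistinguishable. -/
def IsPanPrivate (M : OnlineAlgorithm X S O) (n : ℕ) (ε δ : ℝ) : Prop :=
  ∀ x x' : Fin n → X, (∃ i, ∀ j, j ≠ i → x j = x' j) →
    ∀ t : ℕ, 1 ≤ t → t ≤ n → ∀ T : Set (S × O), MeasurableSet T →
      M.viewLaw (List.ofFn x) t T
        ≤ ENNReal.ofReal (Real.exp ε) * M.viewLaw (List.ofFn x') t T + ENNReal.ofReal δ

/-- The law of the final output when the stream consists of `n` independent samples from `P`. -/
noncomputable def sampleOutputLaw (M : OnlineAlgorithm X S O) (P : Measure X) (n : ℕ) :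
    Measure O :=
  (Measure.pi fun _ : Fin n => P).bind fun x => M.outputLaw (List.ofFn x)

end OnlineAlgorithm

/-- The hypercube `{±1}^d`; `ℤˣ` consists of `1` and `-1`. -/
abbrev SignCube (d : ℕ) : Type := Fin d → ℤˣ

/-- The expectation under `P` of the parity `∏_{j ∈ ℓ} x_j`. -/
noncomputable def parityMean {d : ℕ} (P : Measure (SignCube d)) (ℓ : Finset (Fin d)) : ℝ :=
  ∫ x, ∏ j ∈ ℓ, ((x j : ℤ) : ℝ) ∂P

/-- `M` releases width-`k` parities with error `α` and sample complexity `n`: for every probability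
distribution `P` on `{±1}^d`, on `n` independent samples from `P`, with probability at least
`99/100` the released function `F` is within `α` of the parity means of all sets of size at most
`k` simultaneously. -/
def ReleasesParities {d : ℕ} {S : Type*} [MeasurableSpace S]
    (M : OnlineAlgorithm (SignCube d) S (Finset (Fin d) → ℝ)) (k : ℕ) (α : ℝ) (n : ℕ) : Prop :=
  ∀ P : Measure (SignCube d), IsProbabilityMeasure P →
    ENNReal.ofReal (99 / 100) ≤
      M.sampleOutputLaw P n {F | ∀ ℓ : Finset (Fin d), ℓ.card ≤ k → |F ℓ - parityMean P ℓ| ≤ α}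

/-- `∑_{j=1}^k binom(d, j)`, the number of nonempty subsets of `[d]` of size at most `k`. -/
def chooseLE (d k : ℕ) : ℕ := ∑ j ∈ Finset.Icc 1 k, d.choose j

/-! Let `D = chooseLE d k`, and for each nonempty `v` with `|v| ≤ k` let `P_v` be the law on the
cube whose parity on `v` has mean `β = min 1 (3α)` and whose other nontrivial parities have mean
`0`. Since `β > 2α`, accuracy makes the event `|F v| ≤ α` likely under the uniform law and unlikely
under `P_v` (`ReleasesParities.le_listMean_sub`), so the gaps summed over `v` are at least `0.98 D`.

Conversely, pass from `P_v` samples to uniform ones one at a time, with the uniform samples first.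
The state after the uniform prefix and one further element `a` has a law independent of `v`, and the
biased suffix only contributes a function `g v` of that state with values in `[0, 1]`. Summed over
`v`, one exchange costs `β` times the average over `a` of the expectation of `-∑ v, parity v a * g
v`. Under a state law not depending on `a` this average is `0`. Privacy of the state allows such a
law at a cost `(e^ε - 1) E|∑ v, parity v a * g v| + 2δD`, and the mean absolute value is at most
`√D` by orthogonality of parities (`sum_abs_sum_parity_le`). This is
`IsPanPrivate.sum_hybrid_step_le`.

Hence `0.98 D ≤ n β ((e^ε - 1) √D + 2δD)`. The condition on `δ` gives `δD ≤ ε₀ ε`, and dividing by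
`√D` yields the bound. -/

instance discreteMeasurableSpace_intUnits : DiscreteMeasurableSpace ℤˣ where
  forall_measurableSet s := ⟨Units.val '' s, .of_discrete, by
    rw [Set.preimage_image_eq _ Units.val_injective]⟩

/-! ### Expectations under indistinguishable laws -/

section Indistinguishable

variable {S : Type*} [MeasurableSpace S] {μ ν : Measure S}
  [IsProbabilityMeasure μ] [IsProbabilityMeasure ν]

/-- A one-sided `(log r, δ)`-indistinguishability of events passes to bounded nonnegative
functions. -/
theorem integral_le_of_measureReal_le {r δ D : ℝ}
    (h : ∀ T, MeasurableSet T → μ.real T ≤ r * ν.real T + δ) {f : S → ℝ} (hf : Measurable f)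
    (hf0 : ∀ s, 0 ≤ f s) (hfD : ∀ s, f s ≤ D) :
    ∫ s, f s ∂μ ≤ r * ∫ s, f s ∂ν + δ * D := by
  obtain ⟨s₀⟩ : Nonempty S := μ.nonempty_of_neZero
  have hD : 0 ≤ D := (hf0 s₀).trans (hfD s₀)
  have hint : ∀ (ρ : Measure S) [IsProbabilityMeasure ρ], Integrable f ρ := fun ρ _ =>
    Integrable.of_bound hf.aestronglyMeasurable D (.of_forall fun s => by
      rw [Real.norm_eq_abs, abs_of_nonneg (hf0 s)]; exact hfD s)
  -- Layer cake: the hypothesis on events is applied to each superlevel set, and integrating `δ`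
  -- over `(0, D]` gives `δ * D`.
  have hlayer : ∀ (ρ : Measure S) [IsProbabilityMeasure ρ],
      ∫ s, f s ∂ρ = ∫ t in Set.Ioc 0 D, ρ.real {s | t ≤ f s} := fun ρ _ =>
    (hint ρ).integral_eq_integral_Ioc_meas_le (.of_forall hf0) (.of_forall hfD)
  have hanti : ∀ (ρ : Measure S) [IsProbabilityMeasure ρ],
      IntegrableOn (fun t => ρ.real {s | t ≤ f s}) (Set.Ioc 0 D) := fun ρ _ => by
    have : Antitone fun t => ρ.real {s | t ≤ f s} := fun a b hab =>
      measureReal_mono fun s (hs : b ≤ f s) => hab.trans hs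
    exact (this.antitoneOn _).integrableOn_isCompact isCompact_Icc |>.mono_set
      Set.Ioc_subset_Icc_self
  rw [hlayer μ, hlayer ν]
  calc ∫ t in Set.Ioc 0 D, μ.real {s | t ≤ f s}
      ≤ ∫ t in Set.Ioc 0 D, (r * ν.real {s | t ≤ f s} + δ) :=
        integral_mono (hanti μ) (((hanti ν).const_mul r).add (integrable_const _)) fun t =>
          h _ (measurableSet_le measurable_const hf)
    _ = r * (∫ t in Set.Ioc 0 D, ν.real {s | t ≤ f s}) + δ * D := by
        rw [integral_add ((hanti ν).const_mul r) (integrable_const _), integral_const_mul]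
        simp [hD, mul_comm]

/-- Expectations of a bounded function under two indistinguishable laws are close. -/
theorem integral_le_add_of_indistinguishable {ε δ D : ℝ} (hε : 0 ≤ ε) (hδ : 0 ≤ δ)
    (h : ∀ T, MeasurableSet T → μ.real T ≤ Real.exp ε * ν.real T + δ)
    (h' : ∀ T, MeasurableSet T → ν.real T ≤ Real.exp ε * μ.real T + δ)
    {G : S → ℝ} (hG : Measurable G) (hGD : ∀ s, |G s| ≤ D) :
    ∫ s, G s ∂μ ≤ ∫ s, G s ∂ν + (Real.exp ε - 1) * ∫ s, |G s| ∂ν + 2 * (δ * D) := by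
  obtain ⟨s₀⟩ : Nonempty S := μ.nonempty_of_neZero
  have hD : 0 ≤ D := (abs_nonneg _).trans (hGD s₀)
  have hp : Measurable fun s => max (G s) 0 := hG.max measurable_const
  have hn : Measurable fun s => max (-G s) 0 := hG.neg.max measurable_const
  have hpD : ∀ s, max (G s) 0 ≤ D := fun s => max_le ((le_abs_self _).trans (hGD s)) hD
  have hnD : ∀ s, max (-G s) 0 ≤ D := fun s => max_le ((neg_le_abs _).trans (hGD s)) hD
  have hint : ∀ (ρ : Measure S) [IsProbabilityMeasure ρ] {f : S → ℝ}, Measurable f →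
      (∀ s, 0 ≤ f s) → (∀ s, f s ≤ D) → Integrable f ρ := fun ρ _ f hf hf0 hfD =>
    Integrable.of_bound hf.aestronglyMeasurable D (.of_forall fun s => by
      rw [Real.norm_eq_abs, abs_of_nonneg (hf0 s)]; exact hfD s)
  have hsub : ∀ (ρ : Measure S) [IsProbabilityMeasure ρ],
      ∫ s, G s ∂ρ = ∫ s, max (G s) 0 ∂ρ - ∫ s, max (-G s) 0 ∂ρ := fun ρ _ => by
    rw [← integral_sub (hint ρ hp (fun _ => le_max_right _ _) hpD)
      (hint ρ hn (fun _ => le_max_right _ _) hnD)]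
    congr 1; ext s
    rcases le_total (G s) 0 with hs | hs <;> simp [hs]
  have habs : ∫ s, |G s| ∂ν = ∫ s, max (G s) 0 ∂ν + ∫ s, max (-G s) 0 ∂ν := by
    rw [← integral_add (hint ν hp (fun _ => le_max_right _ _) hpD)
      (hint ν hn (fun _ => le_max_right _ _) hnD)]
    congr 1; ext s
    rcases le_total (G s) 0 with hs | hs <;> simp [hs, abs_of_nonneg, abs_of_nonpos]
  have h1 := integral_le_of_measureReal_le h hp (fun _ => le_max_right _ _) hpD
  have h2 := integral_le_of_measureReal_le h' hn (fun _ => le_max_right _ _) hnD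
  have hn0 : 0 ≤ ∫ s, max (-G s) 0 ∂ν := integral_nonneg fun _ => le_max_right _ _
  have hm0 : 0 ≤ ∫ s, max (-G s) 0 ∂μ := integral_nonneg fun _ => le_max_right _ _
  rw [hsub μ, hsub ν, habs]
  have hr : 1 ≤ Real.exp ε := Real.one_le_exp hε
  have hδD : 0 ≤ δ * D := mul_nonneg hδ hD
  generalize Real.exp ε = r at *
  generalize ∫ s, max (-G s) 0 ∂ν = b at *
  generalize ∫ s, max (-G s) 0 ∂μ = a at *
  -- `b ≤ r a + δ D` gives `a ≥ b - (r - 1) b - δ D`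
  have : (2 - r) * b - δ * D ≤ a := by
    by_contra hlt
    push Not at hlt
    have h3 : r * a ≤ r * ((2 - r) * b - δ * D) := by gcongr
    -- The negation would force `(r - 1)² b + (r - 1) δ D < 0`.
    nlinarith [mul_nonneg (sq_nonneg (r - 1)) hn0, mul_nonneg (sub_nonneg.2 hr) hδD]
  nlinarith

end Indistinguishable

/-! ### Orthogonality of parities on the cube -/

section Parity

variable {d : ℕ}

/-- The parity `∏_{j ∈ ℓ} x_j`. -/
noncomputable def parity (ℓ : Finset (Fin d)) (x : SignCube d) : ℝ := ∏ j ∈ ℓ, ((x j : ℤ) : ℝ)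

theorem parity_sq (ℓ : Finset (Fin d)) (x : SignCube d) : parity ℓ x ^ 2 = 1 := by
  rw [parity, ← Finset.prod_pow]
  refine Finset.prod_eq_one fun j _ => ?_
  rcases Int.units_eq_one_or (x j) with h | h <;> simp [h]

theorem abs_parity (ℓ : Finset (Fin d)) (x : SignCube d) : |parity ℓ x| = 1 := by
  rw [← sq_eq_sq₀ (abs_nonneg _) zero_le_one, sq_abs, parity_sq, one_pow]

/-- The sum factors over coordinates, and a coordinate lying in exactly one of the two sets
contributes the factor `1 + (-1) = 0`. -/
theorem sum_parity_mul_parity (ℓ m : Finset (Fin d)) :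
    ∑ x : SignCube d, parity ℓ x * parity m x = if ℓ = m then 2 ^ d else 0 := by
  have h : ∀ x : SignCube d, parity ℓ x * parity m x
      = ∏ j, (if j ∈ ℓ then ((x j : ℤ) : ℝ) else 1) * (if j ∈ m then ((x j : ℤ) : ℝ) else 1) := by
    intro x
    rw [Finset.prod_mul_distrib, Finset.prod_ite_mem, Finset.prod_ite_mem]
    simp [parity]
  simp_rw [h]
  have := Finset.prod_univ_sum (fun _ : Fin d => (Finset.univ : Finset ℤˣ))
    (fun j u => (if j ∈ ℓ then ((u : ℤ) : ℝ) else 1) * (if j ∈ m then ((u : ℤ) : ℝ) else 1))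
  rw [Fintype.piFinset_univ] at this
  rw [← this]
  split_ifs with heq
  · subst heq
    have : ∀ j : Fin d, ∑ u : ℤˣ, ((if j ∈ ℓ then ((u : ℤ) : ℝ) else 1) *
        (if j ∈ ℓ then ((u : ℤ) : ℝ) else 1)) = 2 := by
      intro j
      rw [UnitsInt.univ, Finset.sum_pair (by decide)]
      split_ifs <;> norm_num
    rw [Finset.prod_congr rfl fun j _ => this j]
    simp
  · obtain ⟨j, hj⟩ : ∃ j, ¬ (j ∈ ℓ ↔ j ∈ m) := by
      by_contra hne
      push Not at hne
      exact heq (Finset.ext hne)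
    refine Finset.prod_eq_zero (Finset.mem_univ j) ?_
    rw [UnitsInt.univ, Finset.sum_pair (by decide)]
    by_cases h1 : j ∈ ℓ <;> by_cases h2 : j ∈ m <;> simp_all

theorem sum_parity {ℓ : Finset (Fin d)} (hℓ : ℓ.Nonempty) : ∑ x : SignCube d, parity ℓ x = 0 := by
  simpa [parity, hℓ.ne_empty] using sum_parity_mul_parity ℓ ∅

theorem card_signCube : (Fintype.card (SignCube d) : ℝ) = 2 ^ d := by
  simp [Fintype.card_units_int]

/-- Parseval and Cauchy–Schwarz: the mean absolute value of a combination of parities with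
coefficients in `[0, 1]` is at most the square root of the number of parities. -/
theorem sum_abs_sum_parity_le (V : Finset (Finset (Fin d))) (g : Finset (Fin d) → ℝ)
    (hg0 : ∀ v, 0 ≤ g v) (hg1 : ∀ v, g v ≤ 1) :
    ∑ x : SignCube d, |∑ v ∈ V, parity v x * g v| ≤ 2 ^ d * Real.sqrt V.card := by
  have hsq : ∑ x : SignCube d, (∑ v ∈ V, parity v x * g v) ^ 2 ≤ 2 ^ d * V.card := by
    calc ∑ x : SignCube d, (∑ v ∈ V, parity v x * g v) ^ 2
        = ∑ v ∈ V, ∑ w ∈ V, (∑ x : SignCube d, parity v x * parity w x) * (g v * g w) := by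
          simp_rw [sq, Finset.sum_mul_sum, Finset.sum_mul]
          rw [Finset.sum_comm]
          refine Finset.sum_congr rfl fun v _ => ?_
          rw [Finset.sum_comm]
          refine Finset.sum_congr rfl fun w _ => Finset.sum_congr rfl fun x _ => by ring
      _ = ∑ v ∈ V, 2 ^ d * (g v * g v) := by
          refine Finset.sum_congr rfl fun v hv => ?_
          simp_rw [sum_parity_mul_parity, ite_mul, zero_mul]
          rw [Finset.sum_ite_eq, if_pos hv]
      _ ≤ ∑ v ∈ V, 2 ^ d * (1 : ℝ) := by
          refine Finset.sum_le_sum fun v _ => ?_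
          have := mul_le_one₀ (hg1 v) (hg0 v) (hg1 v)
          gcongr
      _ = 2 ^ d * V.card := by rw [Finset.sum_const, nsmul_eq_mul]; ring
  refine abs_le_of_sq_le_sq' ?_ (by positivity) |>.2
  calc (∑ x : SignCube d, |∑ v ∈ V, parity v x * g v|) ^ 2
      ≤ 2 ^ d * ∑ x : SignCube d, |∑ v ∈ V, parity v x * g v| ^ 2 := by
        rw [← card_signCube (d := d)]
        exact sq_sum_le_card_mul_sum_sq
    _ ≤ 2 ^ d * (2 ^ d * V.card) := by simp_rw [sq_abs]; gcongr
    _ = (2 ^ d * Real.sqrt V.card) ^ 2 := by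
        rw [mul_pow, Real.sq_sqrt (Nat.cast_nonneg _)]; ring

end Parity

/-! ### Averages over i.i.d. lists -/

section ListMean

variable {X : Type*} [Fintype X]

/-- The mean of `f` over the lists of length `m`, each entry weighted by `w`. -/
def listMean (w : X → ℝ) : ℕ → (List X → ℝ) → ℝ
  | 0, f => f []
  | m + 1, f => ∑ a, w a * listMean w m fun l => f (a :: l)

variable {w : X → ℝ}

theorem listMean_congr {m : ℕ} {f g : List X → ℝ} (h : ∀ l, l.length = m → f l = g l) :
    listMean w m f = listMean w m g := by
  induction m generalizing f g with
  | zero => exact h [] rfl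
  | succ m ih =>
    exact Finset.sum_congr rfl fun a _ => by rw [ih fun l hl => h (a :: l) (by simp [hl])]

theorem listMean_mono (hw : ∀ a, 0 ≤ w a) {m : ℕ} {f g : List X → ℝ}
    (h : ∀ l, l.length = m → f l ≤ g l) : listMean w m f ≤ listMean w m g := by
  induction m generalizing f g with
  | zero => exact h [] rfl
  | succ m ih =>
    exact Finset.sum_le_sum fun a _ =>
      mul_le_mul_of_nonneg_left (ih fun l hl => h (a :: l) (by simp [hl])) (hw a)

theorem listMean_const (hw : ∑ a, w a = 1) (m : ℕ) (c : ℝ) : listMean w m (fun _ => c) = c := by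
  induction m with
  | zero => rfl
  | succ m ih => simp only [listMean, ih, ← Finset.sum_mul, hw, one_mul]

theorem listMean_add (m : ℕ) (f g : List X → ℝ) :
    listMean w m (fun l => f l + g l) = listMean w m f + listMean w m g := by
  induction m generalizing f g with
  | zero => rfl
  | succ m ih => simp only [listMean, ih, mul_add, Finset.sum_add_distrib]

theorem listMean_sum {ι : Type*} (V : Finset ι) (m : ℕ) (f : ι → List X → ℝ) :
    listMean w m (fun l => ∑ v ∈ V, f v l) = ∑ v ∈ V, listMean w m (f v) := by
  induction m generalizing f with
  | zero => rfl
  | succ m ih =>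
    simp only [listMean, ih, Finset.mul_sum]
    exact Finset.sum_comm

/-- The recursion peels off the first entry; the hybrid argument also needs to peel off the last
entry of the uniform prefix. -/
theorem listMean_succ_last (m : ℕ) (f : List X → ℝ) :
    listMean w (m + 1) f = listMean w m fun l => ∑ a, w a * f (l ++ [a]) := by
  induction m generalizing f with
  | zero => rfl
  | succ m ih =>
    exact Finset.sum_congr rfl fun a _ => congrArg (w a * ·) (ih fun l => f (a :: l))

theorem listMean_mem_Icc (hw : ∀ a, 0 ≤ w a) (hw1 : ∑ a, w a = 1) {m : ℕ} {f : List X → ℝ}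
    (h0 : ∀ l, 0 ≤ f l) (h1 : ∀ l, f l ≤ 1) :
    0 ≤ listMean w m f ∧ listMean w m f ≤ 1 :=
  ⟨(listMean_const hw1 m 0).ge.trans (listMean_mono hw fun l _ => h0 l),
    (listMean_mono hw fun l _ => h1 l).trans (listMean_const hw1 m 1).le⟩

theorem measurable_listMean {S : Type*} [MeasurableSpace S] (m : ℕ) {f : S → List X → ℝ}
    (h : ∀ l, Measurable fun s => f s l) : Measurable fun s => listMean w m (f s) := by
  induction m generalizing f with
  | zero => exact h []
  | succ m ih =>
    exact Finset.measurable_fun_sum _ fun a _ => (ih fun l => h (a :: l)).const_mul _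

theorem integrable_and_integral_listMean {S : Type*} [MeasurableSpace S] {μ : Measure S} (m : ℕ)
    {f : S → List X → ℝ} (h : ∀ l, Integrable (fun s => f s l) μ) :
    Integrable (fun s => listMean w m (f s)) μ ∧
      ∫ s, listMean w m (f s) ∂μ = listMean w m fun l => ∫ s, f s l ∂μ := by
  induction m generalizing f with
  | zero => exact ⟨h [], rfl⟩
  | succ m ih =>
    have ih' := fun a : X => ih (f := fun s l => f s (a :: l)) fun l => h (a :: l)
    refine ⟨integrable_finsetSum _ fun a _ => (ih' a).1.const_mul _, ?_⟩
    simp only [listMean]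
    rw [integral_finsetSum _ fun a _ => (ih' a).1.const_mul _]
    exact Finset.sum_congr rfl fun a _ => by rw [integral_const_mul, (ih' a).2]

theorem sum_prod_mul_eq_listMean (m : ℕ) (f : List X → ℝ) :
    ∑ x : Fin m → X, (∏ i, w (x i)) * f (List.ofFn x) = listMean w m f := by
  induction m generalizing f with
  | zero => simp [listMean]
  | succ m ih =>
    rw [← (Fin.consEquiv fun _ => X).sum_comp, Fintype.sum_prod_type, listMean]
    refine Finset.sum_congr rfl fun a _ => ?_
    rw [← ih, Finset.mul_sum]
    refine Finset.sum_congr rfl fun x _ => ?_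
    simp [Fin.consEquiv, Fin.prod_univ_succ, List.ofFn_succ, mul_assoc]

end ListMean

/-! ### Splitting a run at an intermediate state -/

namespace OnlineAlgorithm

variable {X S O : Type*} [MeasurableSpace X] [MeasurableSpace S] [MeasurableSpace O]
  (M : OnlineAlgorithm X S O)

theorem process_append (i : ℕ) (x y : List X) :
    M.process i (x ++ y) = M.process (i + x.length) y ∘ₖ M.process i x := by
  induction x generalizing i with
  | nil => simp [process]
  | cons a x ih =>
    rw [List.cons_append, process, ih, process, Kernel.comp_assoc, List.length_cons,
      add_assoc, add_comm 1]

theorem stateLaw_append {x : List X} (hx : x ≠ []) (y : List X) :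
    M.stateLaw (x ++ y) = (M.stateLaw x).bind (M.process (x.length + 1) y) := by
  cases x with
  | nil => exact absurd rfl hx
  | cons a x =>
    rw [List.cons_append, stateLaw, stateLaw, process_append, Measure.comp_assoc]
    congr 4
    simp [add_comm, add_left_comm]

theorem isProbabilityMeasure_stateLaw {x : List X} (hx : x ≠ []) :
    IsProbabilityMeasure (M.stateLaw x) := by
  have := M.markov_first
  cases x with
  | nil => exact absurd rfl hx
  | cons a x => rw [stateLaw]; infer_instance

theorem isFiniteMeasure_outputLaw (x : List X) : IsFiniteMeasure (M.outputLaw x) := by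
  have := M.markov_output
  rw [outputLaw]; infer_instance

/-- On the empty stream the law is the zero measure, so it need not be a probability measure. -/
theorem outputLaw_real_le_one (x : List X) (E : Set O) : (M.outputLaw x).real E ≤ 1 := by
  have := M.markov_output
  cases x with
  | nil => simp [outputLaw, stateLaw]
  | cons a x =>
    have := M.isProbabilityMeasure_stateLaw (List.cons_ne_nil a x)
    have : IsProbabilityMeasure (M.outputLaw (a :: x)) := by rw [outputLaw]; infer_instance
    exact measureReal_le_one

/-- The probability that the output lands in `E`, for a computation that holds the state `s` before
the `i`-th element of the stream and whose remaining elements are `x`. -/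
noncomputable def outputProb (i : ℕ) (x : List X) (E : Set O) (s : S) : ℝ :=
  ((M.output ∘ₖ M.process i x) s).real E

theorem outputProb_mem (i : ℕ) (x : List X) (E : Set O) (s : S) :
    0 ≤ M.outputProb i x E s ∧ M.outputProb i x E s ≤ 1 := by
  have := M.markov_output
  exact ⟨measureReal_nonneg, measureReal_le_one⟩

theorem measurable_outputProb (i : ℕ) (x : List X) {E : Set O} (hE : MeasurableSet E) :
    Measurable (M.outputProb i x E) :=
  (Kernel.measurable_coe _ hE).ennreal_toReal

/-- By the Markov property the rest of the stream acts as a bounded function of the current state,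
which is what indistinguishability of states can be tested on. -/
theorem outputLaw_append_real {x : List X} (hx : x ≠ []) (y : List X) {E : Set O}
    (hE : MeasurableSet E) :
    (M.outputLaw (x ++ y)).real E = ∫ s, M.outputProb (x.length + 1) y E s ∂M.stateLaw x := by
  have := M.markov_output
  rw [outputLaw, stateLaw_append M hx, Measure.comp_assoc, measureReal_def,
    Measure.bind_apply hE (Kernel.aemeasurable _)]
  exact (integral_toReal (Kernel.measurable_coe _ hE).aemeasurable
    (.of_forall fun s => measure_lt_top _ _)).symm

theorem fst_viewLaw (x : List X) (t : ℕ) : (M.viewLaw x t).fst = M.stateLaw (x.take t) := by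
  have := M.markov_output
  rw [viewLaw, Measure.fst_compProd]

/-- Pan-privacy restricted to the internal state, at the time of the element that is changed. -/
theorem IsPanPrivate.stateLaw_real_le {M : OnlineAlgorithm X S O} {n : ℕ} {ε δ : ℝ} (hδ : 0 ≤ δ)
    (h : M.IsPanPrivate n ε δ) {l : List X} (hl : l.length < n) (a b : X) {T : Set S}
    (hT : MeasurableSet T) :
    (M.stateLaw (l ++ [a])).real T ≤ Real.exp ε * (M.stateLaw (l ++ [b])).real T + δ := by
  -- Privacy concerns streams of length exactly `n`, so `l ++ [c]` is padded by copies of `a`; the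
  -- padding is the same for every `c`.
  have hstream : ∀ c : X, ∃ x : Fin n → X, (∀ i : Fin n, i.1 ≠ l.length →
      x i = (l ++ a :: List.replicate n a)[i.1]'(by simp; omega)) ∧
      (List.ofFn x).take (l.length + 1) = l ++ [c] := by
    intro c
    refine ⟨fun i => (l ++ c :: List.replicate n a)[i.1]'(by simp; omega), ?_, ?_⟩
    · intro i hi
      simp only [List.getElem_append, List.getElem_cons]
      split_ifs <;> first | rfl | omega
    · refine List.ext_getElem (by simp; omega) fun i h1 h2 => ?_
      simp only [List.getElem_take, List.getElem_ofFn, List.getElem_append, List.getElem_cons]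
      simp at h2
      split_ifs <;> first | rfl | omega
  obtain ⟨x, hx, hxa⟩ := hstream a
  obtain ⟨x', hx', hxb⟩ := hstream b
  have key := h x x' ⟨⟨l.length, hl⟩, fun j hj => by
    have hj' : j.1 ≠ l.length := fun h => hj (Fin.ext h)
    rw [hx j hj', hx' j hj']⟩ (l.length + 1) (by omega) hl (Prod.fst ⁻¹' T) (measurable_fst hT)
  rw [← Measure.fst_apply hT, ← Measure.fst_apply hT, fst_viewLaw, fst_viewLaw, hxa, hxb] at key
  have := ENNReal.toReal_mono (by finiteness) key
  rwa [ENNReal.toReal_add (by finiteness) (by finiteness), ENNReal.toReal_mul,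
    ENNReal.toReal_ofReal (Real.exp_pos _).le, ENNReal.toReal_ofReal hδ] at this

end OnlineAlgorithm

/-! ### Distributions with one biased parity -/

section BiasedParity

variable {d : ℕ}

/-- The probability mass function on the cube under which the parity on `v` has mean `β` and every
other nontrivial parity has mean `0`. -/
noncomputable def parityWeight (v : Finset (Fin d)) (β : ℝ) (a : SignCube d) : ℝ :=
  (1 + β * parity v a) / 2 ^ d

theorem parityWeight_nonneg (v : Finset (Fin d)) {β : ℝ} (h0 : 0 ≤ β) (h1 : β ≤ 1)
    (a : SignCube d) : 0 ≤ parityWeight v β a := by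
  refine div_nonneg ?_ (by positivity)
  have := (abs_le.1 (abs_parity v a).le).1
  nlinarith

theorem sum_parityWeight {v : Finset (Fin d)} (hv : v.Nonempty) (β : ℝ) :
    ∑ a, parityWeight v β a = 1 := by
  simp only [parityWeight]
  rw [← Finset.sum_div, Finset.sum_add_distrib, ← Finset.mul_sum, sum_parity hv, Finset.sum_const,
    Finset.card_univ, nsmul_eq_mul, card_signCube]
  simp

theorem parityWeight_zero (v w : Finset (Fin d)) : parityWeight v 0 = parityWeight w 0 := by
  ext a; simp [parityWeight]

/-- The distribution on the cube under which the parity on `v` has mean `β`. -/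
noncomputable def parityMeasure (v : Finset (Fin d)) (β : ℝ) : Measure (SignCube d) :=
  ∑ a, ENNReal.ofReal (parityWeight v β a) • Measure.dirac a

theorem parityMeasure_singleton (v : Finset (Fin d)) (β : ℝ) (a : SignCube d) :
    parityMeasure v β {a} = ENNReal.ofReal (parityWeight v β a) := by
  rw [parityMeasure, Measure.finsetSum_apply, Finset.sum_eq_single a]
  · simp
  · intro b _ hb
    simp [hb]
  · simp

theorem isProbabilityMeasure_parityMeasure {v : Finset (Fin d)} (hv : v.Nonempty) {β : ℝ}
    (h0 : 0 ≤ β) (h1 : β ≤ 1) : IsProbabilityMeasure (parityMeasure v β) := by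
  refine ⟨?_⟩
  rw [parityMeasure, Measure.finsetSum_apply]
  simp only [Measure.smul_apply, measure_univ, smul_eq_mul, mul_one]
  rw [← ENNReal.ofReal_sum_of_nonneg fun a _ => parityWeight_nonneg v h0 h1 a, sum_parityWeight hv,
    ENNReal.ofReal_one]

theorem parityMean_parityMeasure {v : Finset (Fin d)} (hv : v.Nonempty) {β : ℝ}
    (h0 : 0 ≤ β) (h1 : β ≤ 1) : parityMean (parityMeasure v β) v = β := by
  have := isProbabilityMeasure_parityMeasure hv h0 h1
  change ∫ x, parity v x ∂parityMeasure v β = β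
  rw [integral_fintype .of_finite]
  calc ∑ x, (parityMeasure v β).real {x} • parity v x
      = ∑ x, (parity v x + β * (parity v x * parity v x)) / 2 ^ d := by
        refine Finset.sum_congr rfl fun x _ => ?_
        rw [measureReal_def, parityMeasure_singleton,
          ENNReal.toReal_ofReal (parityWeight_nonneg v h0 h1 x), parityWeight, smul_eq_mul]
        ring
    _ = β := by
        rw [← Finset.sum_div, Finset.sum_add_distrib, ← Finset.mul_sum, sum_parity hv,
          sum_parity_mul_parity, if_pos rfl]
        field_simp
        simp

end BiasedParity

/-! ### The hybrid argument -/

namespace OnlineAlgorithm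

theorem sampleOutputLaw_real {X S O : Type*} [MeasurableSpace X] [MeasurableSpace S]
    [MeasurableSpace O] [Fintype X] [DiscreteMeasurableSpace X] (M : OnlineAlgorithm X S O)
    (P : Measure X) [IsProbabilityMeasure P] {w : X → ℝ} (hw : ∀ a, P.real {a} = w a) (n : ℕ)
    {E : Set O} (hE : MeasurableSet E) :
    (M.sampleOutputLaw P n).real E = listMean w n fun x => (M.outputLaw x).real E := by
  have := M.isFiniteMeasure_outputLaw
  rw [sampleOutputLaw, measureReal_def, Measure.bind_apply hE Measurable.of_discrete.aemeasurable,
    lintegral_fintype, ENNReal.toReal_sum fun x _ => by finiteness, ← sum_prod_mul_eq_listMean]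
  refine Finset.sum_congr rfl fun x _ => ?_
  rw [ENNReal.toReal_mul, Measure.pi_singleton, ENNReal.toReal_prod, mul_comm]
  simp_rw [← hw]
  rfl

variable {d : ℕ} {S O : Type*} [MeasurableSpace S] [MeasurableSpace O]
  {M : OnlineAlgorithm (SignCube d) S O} {n : ℕ} {ε δ β : ℝ}

/-- Changing one uniform sample, the first `l.length` of them being fixed, into a sample with a
biased parity hardly changes the output, on average over the parity. -/
theorem IsPanPrivate.sum_hybrid_step_le (hε : 0 ≤ ε) (hδ : 0 ≤ δ) (hβ0 : 0 ≤ β) (hβ1 : β ≤ 1)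
    (hM : M.IsPanPrivate n ε δ) (V : Finset (Finset (Fin d))) (hV : ∀ v ∈ V, v.Nonempty)
    {E : Finset (Fin d) → Set O} (hE : ∀ v, MeasurableSet (E v)) (m : ℕ)
    {l : List (SignCube d)} (hl : l.length < n) :
    ∑ v ∈ V, ∑ a, (parityWeight v 0 a - parityWeight v β a) *
        listMean (parityWeight v β) m (fun y => (M.outputLaw (l ++ a :: y)).real (E v))
      ≤ β * ((Real.exp ε - 1) * Real.sqrt V.card + 2 * (δ * V.card)) := by
  have hprob : ∀ a, IsProbabilityMeasure (M.stateLaw (l ++ [a])) := fun a =>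
    M.isProbabilityMeasure_stateLaw (by simp)
  -- the probability of success when the remaining samples are biased, as a function of the state
  let g : Finset (Fin d) → S → ℝ := fun v s => if v ∈ V then
    listMean (parityWeight v β) m (fun y => M.outputProb (l.length + 2) y (E v) s) else 0
  have hg : ∀ v, Measurable (g v) := by
    intro v
    by_cases hv : v ∈ V
    · simp only [g, hv, if_true]
      exact measurable_listMean m fun y => M.measurable_outputProb _ y (hE v)
    · simp [g, hv]
  -- The value `0` off `V` makes this hold for every `v`: the weights for `v = ∅` sum to `1 + β`, so
  -- the mean itself could exceed `1` there.
  have hg01 : ∀ v s, 0 ≤ g v s ∧ g v s ≤ 1 := by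
    intro v s
    by_cases hv : v ∈ V
    · simp only [g, hv, if_true]
      exact listMean_mem_Icc (parityWeight_nonneg v hβ0 hβ1) (sum_parityWeight (hV v hv) β)
        (fun y => (M.outputProb_mem _ y _ s).1) (fun y => (M.outputProb_mem _ y _ s).2)
    · simp [g, hv]
  have hgint : ∀ (ρ : Measure S) [IsProbabilityMeasure ρ] (v), Integrable (g v) ρ := fun ρ _ v =>
    Integrable.of_bound (hg v).aestronglyMeasurable 1 (.of_forall fun s => by
      rw [Real.norm_eq_abs, abs_of_nonneg (hg01 v s).1]; exact (hg01 v s).2)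
  have hsucc : ∀ v ∈ V, ∀ a, listMean (parityWeight v β) m
      (fun y => (M.outputLaw (l ++ a :: y)).real (E v)) = ∫ s, g v s ∂M.stateLaw (l ++ [a]) := by
    intro v hv a
    simp only [g, hv, if_true]
    rw [(integrable_and_integral_listMean m fun y => Integrable.of_bound
      (M.measurable_outputProb _ y (hE v)).aestronglyMeasurable 1 (.of_forall fun s => by
        rw [Real.norm_eq_abs, abs_of_nonneg (M.outputProb_mem _ y _ s).1]
        exact (M.outputProb_mem _ y _ s).2)).2]
    refine listMean_congr fun y _ => ?_
    rw [List.append_cons, M.outputLaw_append_real (by simp) y (hE v)]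
    simp
  -- The sign comes from `parityWeight v 0 a - parityWeight v β a = -β * parity v a / 2 ^ d`.
  let G : SignCube d → S → ℝ := fun a s => -∑ v ∈ V, parity v a * g v s
  have hG : ∀ a, Measurable (G a) := fun a =>
    (Finset.measurable_fun_sum _ fun v _ => (hg v).const_mul _).neg
  have hGD : ∀ a s, |G a s| ≤ V.card := by
    intro a s
    rw [abs_neg]
    refine (Finset.abs_sum_le_sum_abs _ _).trans ?_
    rw [← nsmul_one]
    refine Finset.sum_le_card_nsmul _ _ _ fun v _ => ?_
    rw [abs_mul, abs_parity, one_mul, abs_of_nonneg (hg01 v s).1]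
    exact (hg01 v s).2
  have hGint : ∀ (ρ : Measure S) [IsProbabilityMeasure ρ] (a), Integrable (G a) ρ := fun ρ _ a =>
    (integrable_finsetSum _ fun v _ => (hgint ρ v).const_mul _).neg
  -- Any fixed last element would do; what matters is that `ρ` does not depend on `a`.
  let ρ := M.stateLaw (l ++ [1])
  have hρ : IsProbabilityMeasure ρ := hprob 1
  have hcompare : ∀ a, ∫ s, G a s ∂M.stateLaw (l ++ [a])
      ≤ ∫ s, G a s ∂ρ + (Real.exp ε - 1) * ∫ s, |G a s| ∂ρ + 2 * (δ * V.card) := fun a =>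
    integral_le_add_of_indistinguishable hε hδ (fun T hT => hM.stateLaw_real_le hδ hl a 1 hT)
      (fun T hT => hM.stateLaw_real_le hδ hl 1 a hT) (hG a) (hGD a)
  have hzero : ∑ a, ∫ s, G a s ∂ρ = 0 := by
    rw [← integral_finsetSum _ fun a _ => hGint ρ a]
    have : ∀ s, ∑ a, G a s = 0 := by
      intro s
      simp only [G]
      rw [Finset.sum_neg_distrib, Finset.sum_comm, neg_eq_zero]
      refine Finset.sum_eq_zero fun v hv => ?_
      rw [← Finset.sum_mul, sum_parity (hV v hv), zero_mul]
    simp [this]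
  have habs : ∑ a, ∫ s, |G a s| ∂ρ ≤ 2 ^ d * Real.sqrt V.card := by
    rw [← integral_finsetSum _ fun a _ => (hGint ρ a).abs]
    calc ∫ s, ∑ a, |G a s| ∂ρ ≤ ∫ _, 2 ^ d * Real.sqrt V.card ∂ρ := by
          refine integral_mono (integrable_finsetSum _ fun a _ => (hGint ρ a).abs)
            (integrable_const _) fun s => ?_
          simp only [G, abs_neg]
          exact sum_abs_sum_parity_le V (fun v => g v s) (fun v => (hg01 v s).1)
            (fun v => (hg01 v s).2)
      _ = _ := by simp
  calc ∑ v ∈ V, ∑ a, (parityWeight v 0 a - parityWeight v β a) *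
        listMean (parityWeight v β) m (fun y => (M.outputLaw (l ++ a :: y)).real (E v))
      = β / 2 ^ d * ∑ a, ∫ s, G a s ∂M.stateLaw (l ++ [a]) := by
        rw [Finset.sum_comm, Finset.mul_sum]
        refine Finset.sum_congr rfl fun a _ => ?_
        simp only [G]
        rw [integral_neg, integral_finsetSum _ fun v _ => (hgint _ v).const_mul _,
          ← Finset.sum_neg_distrib, Finset.mul_sum]
        refine Finset.sum_congr rfl fun v hv => ?_
        rw [hsucc v hv a, integral_const_mul, parityWeight, parityWeight]
        ring
    _ ≤ β / 2 ^ d * ∑ a, (∫ s, G a s ∂ρ + (Real.exp ε - 1) * ∫ s, |G a s| ∂ρ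
          + 2 * (δ * V.card)) := by
        gcongr with a
        exact hcompare a
    _ = β / 2 ^ d * ((Real.exp ε - 1) * ∑ a, ∫ s, |G a s| ∂ρ + 2 ^ d * (2 * (δ * V.card))) := by
        rw [Finset.sum_add_distrib, Finset.sum_add_distrib, hzero, ← Finset.mul_sum,
          Finset.sum_const, Finset.card_univ, nsmul_eq_mul, card_signCube, zero_add]
    _ ≤ β / 2 ^ d * ((Real.exp ε - 1) * (2 ^ d * Real.sqrt V.card)
          + 2 ^ d * (2 * (δ * V.card))) := by
        have := sub_nonneg.2 (Real.one_le_exp hε)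
        gcongr
    _ = β * ((Real.exp ε - 1) * Real.sqrt V.card + 2 * (δ * V.card)) := by
        field_simp

/-- The hybrid argument: uniform samples and samples with a biased parity lead to similar outputs,
on average over the parity. -/
theorem IsPanPrivate.sum_listMean_sub_le (hε : 0 ≤ ε) (hδ : 0 ≤ δ) (hβ0 : 0 ≤ β) (hβ1 : β ≤ 1)
    (hM : M.IsPanPrivate n ε δ) (V : Finset (Finset (Fin d))) (hV : ∀ v ∈ V, v.Nonempty)
    {E : Finset (Fin d) → Set O} (hE : ∀ v, MeasurableSet (E v)) :
    ∑ v ∈ V, (listMean (parityWeight v 0) n (fun x => (M.outputLaw x).real (E v)) -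
        listMean (parityWeight v β) n (fun x => (M.outputLaw x).real (E v)))
      ≤ n * (β * ((Real.exp ε - 1) * Real.sqrt V.card + 2 * (δ * V.card))) := by
  let u : SignCube d → ℝ := parityWeight ∅ 0
  have hu0 : ∀ a, 0 ≤ u a := parityWeight_nonneg _ le_rfl zero_le_one
  rcases V.eq_empty_or_nonempty with rfl | ⟨v₀, hv₀⟩
  · simp
  have hu1 : ∑ a, u a = 1 := by
    rw [show u = parityWeight v₀ 0 from parityWeight_zero _ _]
    exact sum_parityWeight (hV v₀ hv₀) 0
  -- The first `t` samples are uniform, the others biased. This order keeps the prefix, and hence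
  -- its state, independent of `v`.
  let H : ℕ → ℝ := fun t => ∑ v ∈ V, listMean u t fun x =>
    listMean (parityWeight v β) (n - t) fun y => (M.outputLaw (x ++ y)).real (E v)
  have hstep : ∀ t ∈ Finset.range n, H (t + 1) - H t
      ≤ β * ((Real.exp ε - 1) * Real.sqrt V.card + 2 * (δ * V.card)) := by
    intro t ht
    obtain ⟨m, hm⟩ : ∃ m, n = t + 1 + m := Nat.exists_eq_add_of_le (Finset.mem_range.1 ht)
    have h1 : n - (t + 1) = m := by omega
    have h2 : n - t = m + 1 := by omega
    have : H (t + 1) = H t + listMean u t fun x => ∑ v ∈ V,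
        ∑ a, (parityWeight v 0 a - parityWeight v β a) *
          listMean (parityWeight v β) m (fun y => (M.outputLaw (x ++ a :: y)).real (E v)) := by
      rw [listMean_sum, ← Finset.sum_add_distrib]
      refine Finset.sum_congr rfl fun v _ => ?_
      rw [← listMean_add, h1, h2, listMean_succ_last]
      congr 1
      ext x
      rw [listMean, ← Finset.sum_add_distrib]
      refine Finset.sum_congr rfl fun a _ => ?_
      simp only [List.append_assoc, List.singleton_append, u, parityWeight_zero ∅ v]
      ring
    rw [this, add_sub_cancel_left, ← listMean_const hu1 t (β * _)]
    refine listMean_mono hu0 fun x hx => ?_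
    exact hM.sum_hybrid_step_le hε hδ hβ0 hβ1 V hV hE m (by omega)
  have htel := Finset.sum_le_card_nsmul _ _ _ hstep
  rw [Finset.sum_range_sub, Finset.card_range, nsmul_eq_mul] at htel
  refine le_of_eq_of_le ?_ htel
  rw [Finset.sum_sub_distrib]
  congr 1
  · refine Finset.sum_congr rfl fun v _ => ?_
    simp [listMean, u, parityWeight_zero ∅ v]

end OnlineAlgorithm

/-! ### Counting, accuracy and the final bound -/

/-- The nonempty subsets of `[d]` of size at most `k`. -/
def nonemptySubsetsLE (d k : ℕ) : Finset (Finset (Fin d)) :=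
  (Finset.Icc 1 k).biUnion fun j => Finset.powersetCard j Finset.univ

theorem mem_nonemptySubsetsLE {d k : ℕ} {v : Finset (Fin d)} :
    v ∈ nonemptySubsetsLE d k ↔ v.Nonempty ∧ v.card ≤ k := by
  simp [nonemptySubsetsLE, Finset.mem_powersetCard, Nat.one_le_iff_ne_zero,
    Finset.nonempty_iff_ne_empty]

theorem card_nonemptySubsetsLE (d k : ℕ) : (nonemptySubsetsLE d k).card = chooseLE d k := by
  rw [nonemptySubsetsLE, Finset.card_biUnion, chooseLE]
  · simp
  · intro i _ j _ hij
    exact Finset.pairwise_disjoint_powersetCard _ hij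

theorem three_le_chooseLE {d k : ℕ} (hk : 2 ≤ k) (hkd : k ≤ d) : 3 ≤ chooseLE d k := by
  calc 3 ≤ d.choose 1 + d.choose 2 := by
        have h : (2 : ℕ).choose 2 ≤ d.choose 2 := Nat.choose_le_choose 2 (hk.trans hkd)
        simp at h ⊢
        omega
    _ = ∑ j ∈ Finset.Icc 1 2, d.choose j := by
        rw [show Finset.Icc 1 2 = ({1, 2} : Finset ℕ) from rfl, Finset.sum_pair (by decide)]
    _ ≤ chooseLE d k := Finset.sum_le_sum_of_subset (Finset.Icc_subset_Icc_right hk)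

/-- For `δ > 0` the logarithm is at least `1`, because `D / δ ≥ 3 > e`. -/
theorem le_mul_log_div {δ D : ℝ} (hδ0 : 0 ≤ δ) (hδ1 : δ ≤ 1) (hD : 3 ≤ D) :
    δ ≤ δ * Real.log (D / δ) := by
  rcases hδ0.eq_or_lt with rfl | hpos
  · simp
  refine le_mul_of_one_le_right hδ0 ?_
  rw [Real.le_log_iff_exp_le (by positivity), le_div_iff₀ hpos]
  nlinarith [Real.exp_one_lt_d9, Real.exp_pos 1]

/-- An accurate algorithm tells the uniform distribution from one with a biased parity. -/
theorem ReleasesParities.le_listMean_sub {d k n : ℕ} {α β : ℝ} {S : Type*} [MeasurableSpace S]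
    {M : OnlineAlgorithm (SignCube d) S (Finset (Fin d) → ℝ)} (h : ReleasesParities M k α n)
    (hβ : 2 * α < β) (hβ0 : 0 ≤ β) (hβ1 : β ≤ 1) {v : Finset (Fin d)} (hv : v.Nonempty)
    (hvk : v.card ≤ k) :
    98 / 100 ≤ listMean (parityWeight v 0) n (fun x => (M.outputLaw x).real {F | |F v| ≤ α}) -
      listMean (parityWeight v β) n (fun x => (M.outputLaw x).real {F | |F v| ≤ α}) := by
  have hmeas : ∀ c : ℝ, MeasurableSet {F : Finset (Fin d) → ℝ | |F v - c| ≤ α} := fun c =>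
    measurableSet_le (by fun_prop) measurable_const
  have hreal : ∀ γ : ℝ, 0 ≤ γ → γ ≤ 1 → 99 / 100 ≤
      listMean (parityWeight v γ) n (fun x => (M.outputLaw x).real {F | |F v - γ| ≤ α}) := by
    intro γ h0 h1
    have hP := isProbabilityMeasure_parityMeasure hv h0 h1
    have hw : ∀ a, (parityMeasure v γ).real {a} = parityWeight v γ a := fun a => by
      rw [measureReal_def, parityMeasure_singleton,
        ENNReal.toReal_ofReal (parityWeight_nonneg v h0 h1 a)]
    rw [← M.sampleOutputLaw_real (parityMeasure v γ) hw n (hmeas γ), measureReal_def]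
    have hle : ENNReal.ofReal (99 / 100) ≤
        M.sampleOutputLaw (parityMeasure v γ) n {F | |F v - γ| ≤ α} :=
      (h _ hP).trans <| measure_mono fun F hF => by
        simpa [parityMean_parityMeasure hv h0 h1] using hF v hvk
    have hfin : M.sampleOutputLaw (parityMeasure v γ) n {F | |F v - γ| ≤ α} ≠ ⊤ := by
      have := M.isFiniteMeasure_outputLaw
      rw [OnlineAlgorithm.sampleOutputLaw,
        Measure.bind_apply (hmeas γ) Measurable.of_discrete.aemeasurable, lintegral_fintype]
      exact ENNReal.sum_ne_top.2 fun x _ => by finiteness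
    have hle' := ENNReal.toReal_mono hfin hle
    rwa [ENNReal.toReal_ofReal (by norm_num)] at hle'
  have h0 := hreal 0 le_rfl zero_le_one
  -- The intervals of radius `α` around `0` and `β` are disjoint because `β > 2α`.
  have hdisj : listMean (parityWeight v β) n (fun x => (M.outputLaw x).real {F | |F v| ≤ α}) +
      listMean (parityWeight v β) n (fun x => (M.outputLaw x).real {F | |F v - β| ≤ α}) ≤ 1 := by
    rw [← listMean_add, ← listMean_const (sum_parityWeight hv β) n 1]
    refine listMean_mono (parityWeight_nonneg v hβ0 hβ1) fun x _ => ?_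
    have := M.isFiniteMeasure_outputLaw x
    rw [← measureReal_union _ (hmeas β)]
    · exact M.outputLaw_real_le_one x _
    · refine Set.disjoint_left.2 fun F (h1 : |F v| ≤ α) (h2 : |F v - β| ≤ α) => ?_
      have := abs_le.1 h1
      have := abs_le.1 h2
      linarith
  have h1 := hreal β hβ0 hβ1
  simp only [sub_zero] at h0
  linarith

theorem mainTheorem7 (ε₀ : ℝ) (hε₀ : 0 < ε₀) :
    ∃ c : ℝ, 0 < c ∧ ∃ C : ℝ, 0 < C ∧
      ∀ (d k n : ℕ) (α ε δ : ℝ) (S : Type*) [MeasurableSpace S]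
        (M : OnlineAlgorithm (SignCube d) S (Finset (Fin d) → ℝ)),
        2 ≤ k → k ≤ d → 0 < α → α < 1 / 2 → 0 < ε → ε ≤ ε₀ → 0 ≤ δ → δ ≤ 1 →
        δ * Real.log ((chooseLE d k : ℝ) / δ) ≤ c * (α ^ 2 * ε ^ 2 / (chooseLE d k : ℝ)) →
        M.IsPanPrivate n ε δ →
        ReleasesParities M k α n →
        C * (Real.sqrt (chooseLE d k : ℝ) / (α * ε)) ≤ (n : ℝ) := by
  refine ⟨1, one_pos, 98 / 100 / (3 * (Real.exp ε₀ + 2 * ε₀)), by positivity, ?_⟩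
  intro d k n α ε δ S _ M hk hkd hα hα2 hε hεε₀ hδ0 hδ1 hδ hpan hrel
  have hD3 : (3 : ℝ) ≤ chooseLE d k := by exact_mod_cast three_le_chooseLE hk hkd
  -- The bias `min 1 (3 * α)` is at most `1`, as a parity mean must be, and exceeds `2 * α` because
  -- `α < 1 / 2`.
  have hgap := Finset.card_nsmul_le_sum (nonemptySubsetsLE d k) _ (98 / 100 : ℝ) fun v hv =>
    hrel.le_listMean_sub (β := min 1 (3 * α)) (lt_min (by linarith) (by linarith))
      (le_min zero_le_one (by positivity)) (min_le_left _ _) (mem_nonemptySubsetsLE.1 hv).1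
      (mem_nonemptySubsetsLE.1 hv).2
  have hup := hpan.sum_listMean_sub_le (β := min 1 (3 * α)) hε.le hδ0
    (le_min zero_le_one (by positivity)) (min_le_left _ _) (nonemptySubsetsLE d k)
    (fun v hv => (mem_nonemptySubsetsLE.1 hv).1)
    (E := fun v => {F : Finset (Fin d) → ℝ | |F v| ≤ α})
    (fun v => measurableSet_le (by fun_prop) measurable_const)
  have hmain := hgap.trans hup
  rw [card_nonemptySubsetsLE, nsmul_eq_mul] at hmain
  -- The chain is `δ D ≤ α² ε² ≤ ε² ≤ ε₀ ε`.
  have hδD : δ * chooseLE d k ≤ ε₀ * ε := by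
    have h := (le_mul_log_div hδ0 hδ1 hD3).trans hδ
    rw [one_mul, le_div_iff₀ (by linarith)] at h
    have hα1 : α ^ 2 ≤ 1 := by nlinarith
    nlinarith [mul_le_mul_of_nonneg_right hα1 (sq_nonneg ε)]
  -- Multiplying `1 - ε ≤ e^(-ε)` by `e^ε` gives `e^ε - 1 ≤ ε e^ε`.
  have hexp : Real.exp ε - 1 ≤ ε * Real.exp ε₀ := by
    have h1 := Real.add_one_le_exp (-ε)
    have h2 : Real.exp (-ε) * Real.exp ε = 1 := by rw [← Real.exp_add]; simp
    have h3 := Real.exp_le_exp.2 hεε₀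
    nlinarith [Real.exp_pos ε]
  have hs1 : 1 ≤ Real.sqrt (chooseLE d k) := Real.one_le_sqrt.2 (by linarith)
  have hss : Real.sqrt (chooseLE d k) * Real.sqrt (chooseLE d k) = chooseLE d k :=
    Real.mul_self_sqrt (by linarith)
  generalize Real.sqrt (chooseLE d k) = s at *
  have hbound : (chooseLE d k : ℝ) * (98 / 100) ≤
      n * (3 * α * (ε * Real.exp ε₀ * s + 2 * (ε₀ * ε * s))) := by
    refine hmain.trans ?_
    have h0 : 0 ≤ Real.exp ε - 1 := sub_nonneg.2 (Real.one_le_exp hε.le)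
    have h1 : δ * chooseLE d k ≤ ε₀ * ε * s :=
      hδD.trans (le_mul_of_one_le_right (by positivity) hs1)
    have hDpos : (0 : ℝ) ≤ chooseLE d k := by linarith
    gcongr
    exact min_le_right _ _
  rw [← hss] at hbound
  have hspos : 0 < s := by linarith
  have hfinal : s * (98 / 100) ≤ n * (3 * α * ε * (Real.exp ε₀ + 2 * ε₀)) := by
    refine le_of_mul_le_mul_left ?_ hspos
    calc s * (s * (98 / 100)) = s * s * (98 / 100) := by ring
      _ ≤ _ := hbound
      _ = _ := by ring
  rw [div_mul_div_comm, div_le_iff₀ (by positivity)]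
  calc 98 / 100 * s = s * (98 / 100) := by ring
    _ ≤ _ := hfinal
    _ = _ := by ring
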